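/- **Theorem (Minimum-noise coverage rule).** For a probability law $\mu$ on $\mathbb{R}$ let $Q_p(\mu)=\inf\{x : \mu((-\infty,x])\ge p\}$ be its quantile function, $R_\tau(\mu)=Q_{1-\tau/2}(\mu)$ its $\tau$-tail radius, and $\kappa(\mu)=\mathbb{E}[(X-\mathbb{E}X)^4]/(\operatorname{Var}X)^2$ ($X\sim\mu$) its kurtosis. Let $\Phi$ be the standard normal distribution function and $\Phi^{-1}$ its inverse. (i) Let $\mu$ have unit variance and a unimodal density that is symmetric about $0$, and let $\tau,\alpha\in(0,1)$. Then the problem of minimising $\sigma$ over all $\sigma>0$ with $$\Pr_{\varepsilon\sim\mathcal N(0,\sigma^2)}\bigl[\,|\varepsilon|\ge R_\tau(\mu)\,\bigr]\ \ge\ \alpha$$ has exactly one solution, namely $$\sigma^*=\frac{R_\tau(\mu)}{\Phi^{-1}(1-\alpha/2)} .$$ (ii) (Generalised Gaussian family.) For $\beta>0$ let $\mu_\beta$ be the law with density proportional to $\exp(-(|x|/a)^\beta)$, where $a=a(\beta)=(\Gamma(1/\beta)/\Gamma(3/\beta))^{1/2}$, so that the variance is $1$. For every compact interval $[b_0,b_1]\subset(0,\infty)$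 there is a threshold $\tau^*_{\mathrm{GGD}}>0$ such that for every $\tau\in(0,\tau^*_{\mathrm{GGD}})$ and every $\alpha\in(0,1)$ the minimal scale $\sigma^*$ of $\mu_\beta$, $\beta\in[b_0,b_1]$, exists, depends only on the kurtosis $\kappa=\kappa(\mu_\beta)$, and is strictly increasing in $\kappa$. (iii) (Student-$t$ family.) There is a threshold $\tau^*_t>0$ such that for every $\tau\in(0,\tau^*_t)$ and every $\alpha\in(0,1)$ the minimal scale $\sigma^*$ of the Student-$t$ law with $\nu>4$ degrees of freedom, rescaled by $\sqrt{(\nu-2)/\nu}$ to unit variance, exists, depends only on the kurtosis $\kappa$ of that law, and is strictly increasing in $\kappa$ over the whole range $\nu\in(4,\infty)$. -/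

import Mathlib

open MeasureTheory ProbabilityTheory Set
open scoped ENNReal

noncomputable section

namespace TailCoverage

/-- The quantile function (generalised inverse of the distribution function) of a law on `ℝ`:
`Q_p = inf {x | p ≤ F(x)}`. -/
def quantile (μ : Measure ℝ) (p : ℝ) : ℝ :=
  sInf {x : ℝ | p ≤ cdf μ x}

/-- `Φ⁻¹(p)`, the quantile function of the standard normal law. -/
def stdNormalQuantile (p : ℝ) : ℝ :=
  quantile (gaussianReal 0 1) p

/-- The `τ`-tail radius `R_τ = Q_{1 - τ/2}`. -/
def tailRadius (μ : Measure ℝ) (τ : ℝ) : ℝ :=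
  quantile μ (1 - τ / 2)

/-- Kurtosis: the fourth standardised moment `E[(X - E X)^4] / (Var X)^2`. -/
def kurtosis (μ : Measure ℝ) : ℝ :=
  centralMoment id 4 μ / (variance id μ) ^ 2

/-- A density is unimodal if it increases up to some mode `m` and decreases afterwards.
The density may take the value `∞` (at the mode). -/
def IsUnimodal (p : ℝ → ℝ≥0∞) : Prop :=
  ∃ m : ℝ, MonotoneOn p (Iic m) ∧ AntitoneOn p (Ici m)

/-- `μ` is a standardised marginal: a probability law on `ℝ` with unit variance and a unimodal
density that is symmetric about `0`. -/
structure IsStdSymmUnimodal (μ : Measure ℝ) : Prop where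
  isProbabilityMeasure : IsProbabilityMeasure μ
  exists_density : ∃ p : ℝ → ℝ≥0∞, Measurable p ∧ μ = volume.withDensity p ∧
    (∀ x, p (-x) = p x) ∧ IsUnimodal p
  variance_eq_one : variance id μ = 1

/-- The feasible noise scales: all `σ > 0` such that `ε ∼ N(0, σ²)` satisfies
`P(|ε| ≥ R_τ) ≥ α`. -/
def feasibleScales (μ : Measure ℝ) (τ α : ℝ) : Set ℝ :=
  {σ : ℝ | 0 < σ ∧
    α ≤ (gaussianReal 0 (Real.toNNReal (σ ^ 2))).real {ε : ℝ | tailRadius μ τ ≤ |ε|}}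

/-- The scale `a(β) = (Γ(1/β) / Γ(3/β))^{1/2}` for which the generalised Gaussian law has unit
variance. -/
def ggdScale (β : ℝ) : ℝ :=
  √(Real.Gamma (1 / β) / Real.Gamma (3 / β))

/-- The generalised Gaussian density with shape `β` and scale `a`, proportional to
`exp(-(|x|/a)^β)`. -/
def ggdPDF (β a x : ℝ) : ℝ :=
  β / (2 * a * Real.Gamma (1 / β)) * Real.exp (-(|x| / a) ^ β)

/-- The unit-variance generalised Gaussian law with shape `β`. -/
def ggd (β : ℝ) : Measure ℝ :=
  volume.withDensity fun x => ENNReal.ofReal (ggdPDF β (ggdScale β) x)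

/-- The density of `s · T`, where `T` has the Student-t law with `ν` degrees of freedom. -/
def studentPDF (ν s x : ℝ) : ℝ :=
  Real.Gamma ((ν + 1) / 2) / (√(ν * Real.pi) * Real.Gamma (ν / 2) * s) *
    (1 + (x / s) ^ 2 / ν) ^ (-((ν + 1) / 2))

/-- The Student-t law with `ν` degrees of freedom (a real number `> 2`), rescaled by
`((ν - 2)/ν)^{1/2}` to unit variance. -/
def stdStudent (ν : ℝ) : Measure ℝ :=
  volume.withDensity fun x => ENNReal.ofReal (studentPDF ν (√((ν - 2) / ν)) x)

/-- On the parametric family of laws `P θ`, `θ ∈ I`, the minimum-noise scale at tail level `τ` and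
coverage level `α` exists, is a well-defined function `s` of the kurtosis `κ`, and is strictly
increasing on the set of kurtosis values attained by the family. -/
def MinScaleStrictMonoInKurtosis (P : ℝ → Measure ℝ) (I : Set ℝ) (τ α : ℝ) : Prop :=
  ∃ s : ℝ → ℝ, (∀ θ ∈ I, IsLeast (feasibleScales (P θ) τ α) (s (kurtosis (P θ)))) ∧
    StrictMonoOn s ((fun θ => kurtosis (P θ)) '' I)

end TailCoverage

end

/-! Writing the noise as σZ with Z standard normal, the coverage is 2(1 - Φ(R/σ)), where R is the
tail radius. It is at least α exactly when σ ≥ R/Φ⁻¹(1-α/2), so the feasible scales form a closed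
half-line. Part (i) then needs only R > 0, which follows from symmetry and the absence of atoms.

Since Φ⁻¹(1-α/2) is a positive constant, (ii) and (iii) say that R increases with the kurtosis. In
both families the kurtosis strictly decreases in the shape parameter, hence determines it, and it
remains to show that R strictly decreases as well (`minScaleStrictMonoInKurtosis`). This holds as
soon as the densities are strictly ordered beyond a point x₀ common to the family and τ/2 is below
every tail mass past x₀ (`strictAntiOn_tailRadius`).

For the generalised Gaussian laws the kurtosis is a Gamma ratio, monotone by Euler's product. The
log normalising constant and β log a(β) are Lipschitz on a compact range, whereas β log x moves at
speed log x; this gives a common x₀. For Student laws the kurtosis is 3 + 6/(ν-4). The density is a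
constant nonincreasing in ν times a kernel that strictly decreases in ν once x > 9, and a Gaussian
minorant keeps the tail mass away from 0 over the unbounded range of ν. -/

noncomputable section

namespace TailCoverage

open Filter Topology

/-! ### Quantiles and symmetric laws -/

section Quantile

variable {μ : Measure ℝ}

/-- Galois connection between the quantile function and the distribution function. -/
theorem quantile_le_iff {p : ℝ} (hp0 : 0 < p) (hp1 : p < 1) (x : ℝ) :
    quantile μ p ≤ x ↔ p ≤ cdf μ x := by
  have hbdd : BddBelow {x : ℝ | p ≤ cdf μ x} := by
    obtain ⟨b, hb⟩ := ((tendsto_cdf_atBot μ).eventually (gt_mem_nhds hp0)).exists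
    refine ⟨b, fun y hy => ?_⟩
    by_contra! h
    exact absurd (hy.trans (monotone_cdf μ h.le)) (not_le.2 hb)
  have hne : {x : ℝ | p ≤ cdf μ x}.Nonempty := by
    obtain ⟨b, hb⟩ := ((tendsto_cdf_atTop μ).eventually (lt_mem_nhds hp1)).exists
    exact ⟨b, hb.le⟩
  refine ⟨fun h => ?_, fun h => csInf_le hbdd h⟩
  -- Right-continuity of the distribution function makes the infimum attained.
  have hQ : p ≤ cdf μ (quantile μ p) := by
    have ht : Tendsto (cdf μ) (𝓝[>] (quantile μ p)) (𝓝 (cdf μ (quantile μ p))) :=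
      ((cdf μ).right_continuous _).mono_left (nhdsWithin_mono _ Ioi_subset_Ici_self)
    refine ge_of_tendsto ht ?_
    filter_upwards [self_mem_nhdsWithin] with y hy
    obtain ⟨z, hz, hzy⟩ := exists_lt_of_csInf_lt hne hy
    exact le_trans hz (monotone_cdf μ hzy.le)
  exact hQ.trans (monotone_cdf μ h)

variable [IsProbabilityMeasure μ]

theorem continuous_cdf [NullSingletonClass μ] : Continuous (cdf μ) := by
  rw [continuous_iff_continuousAt]
  intro x
  rw [(monotone_cdf μ).continuousAt_iff_leftLim_eq_rightLim, (cdf μ).rightLim_eq]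
  have h := (cdf μ).measure_singleton x
  rw [measure_cdf, measure_singleton, eq_comm, ENNReal.ofReal_eq_zero, sub_nonpos] at h
  exact le_antisymm ((monotone_cdf μ).leftLim_le le_rfl) h

theorem cdf_quantile [NullSingletonClass μ] {p : ℝ} (hp0 : 0 < p) (hp1 : p < 1) :
    cdf μ (quantile μ p) = p := by
  refine le_antisymm ?_ ((quantile_le_iff hp0 hp1 _).1 le_rfl)
  by_contra! h
  have hc := (continuous_cdf (μ := μ)).continuousAt (x := quantile μ p)
  obtain ⟨y, hy, hyQ⟩ := (((hc.tendsto.eventually (lt_mem_nhds h)).filter_mono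
    nhdsWithin_le_nhds).and (self_mem_nhdsWithin (s := Iio (quantile μ p)))).exists
  exact absurd ((quantile_le_iff hp0 hp1 y).2 hy.le) (not_le.2 hyQ)

theorem one_sub_cdf (x : ℝ) : 1 - cdf μ x = μ.real (Ioi x) := by
  rw [cdf_eq_real, ← probReal_compl_eq_one_sub measurableSet_Iic, compl_Iic]

/-- The two tails of a symmetric law agree. -/
theorem real_Iic_neg [NullSingletonClass μ] (hμ : μ.map (fun x => -x) = μ) (x : ℝ) :
    μ.real (Iic (-x)) = 1 - cdf μ x := by
  rw [one_sub_cdf]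
  conv_lhs => rw [← hμ]
  rw [map_measureReal_apply measurable_neg measurableSet_Iic]
  have : (fun x : ℝ => -x) ⁻¹' Iic (-x) = Ici x := by ext y; simp
  rw [this, measureReal_congr Ioi_ae_eq_Ici]

theorem cdf_zero_of_symm [NullSingletonClass μ] (hμ : μ.map (fun x => -x) = μ) : cdf μ 0 = 1 / 2 := by
  have := real_Iic_neg hμ 0
  rw [neg_zero, ← cdf_eq_real] at this
  linarith

theorem real_le_abs [NullSingletonClass μ] (hμ : μ.map (fun x => -x) = μ) {r : ℝ} (hr : 0 < r) :
    μ.real {x | r ≤ |x|} = 2 * (1 - cdf μ r) := by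
  have hs : {x : ℝ | r ≤ |x|} = Ici r ∪ Iic (-r) := by
    ext x
    simp only [mem_ofPred_eq, le_abs, mem_union, mem_Ici, mem_Iic, le_neg]
  have hd : Disjoint (Ici r) (Iic (-r)) := by
    rw [Set.disjoint_left]
    intro x hx hx'
    simp only [mem_Ici, mem_Iic] at hx hx'
    linarith
  rw [hs, measureReal_union hd measurableSet_Iic, real_Iic_neg hμ,
    ← measureReal_congr Ioi_ae_eq_Ici, ← one_sub_cdf]
  ring

theorem quantile_pos_of_symm [NullSingletonClass μ] (hμ : μ.map (fun x => -x) = μ) {p : ℝ}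
    (hp : 1 / 2 < p) (hp1 : p < 1) : 0 < quantile μ p := by
  rw [← not_le, quantile_le_iff (by linarith) hp1, cdf_zero_of_symm hμ]
  linarith

end Quantile

/-! ### Gaussian coverage and the minimal scale -/

section Coverage

instance : NullSingletonClass (gaussianReal 0 1) := nullSingletonClass_gaussianReal one_ne_zero

theorem gaussianReal_symm : (gaussianReal 0 1).map (fun x => -x) = gaussianReal 0 1 := by
  simpa using gaussianReal_map_neg (μ := 0) (v := 1)

theorem strictMono_cdf_gaussianReal : StrictMono (cdf (gaussianReal 0 1)) := by
  intro a b hab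
  rw [cdf_eq_real, cdf_eq_real, ← Iic_union_Ioc_eq_Iic hab.le,
    measureReal_union (by
      rw [Set.disjoint_left]; intro x hx hx'; exact absurd hx'.1 (not_lt.2 hx)) measurableSet_Ioc]
  have : (gaussianReal 0 1).real (Ioc a b) ≠ 0 := by
    rw [measureReal_ne_zero_iff]
    intro h
    have h0 := gaussianReal_absolutelyContinuous' 0 one_ne_zero h
    rw [Real.volume_Ioc, ENNReal.ofReal_eq_zero] at h0
    linarith
  have := lt_of_le_of_ne (measureReal_nonneg (μ := gaussianReal 0 1) (s := Ioc a b)) this.symm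
  linarith

theorem stdNormalQuantile_pos {α : ℝ} (hα : α ∈ Ioo (0 : ℝ) 1) :
    0 < stdNormalQuantile (1 - α / 2) :=
  quantile_pos_of_symm gaussianReal_symm (by linarith [hα.2]) (by linarith [hα.1])

/-- Coverage of the two-sided tail by centred Gaussian noise. -/
theorem gaussian_coverage_iff {σ r α : ℝ} (hσ : 0 < σ) (hr : 0 < r) (hα : α ∈ Ioo (0 : ℝ) 1) :
    α ≤ (gaussianReal 0 (Real.toNNReal (σ ^ 2))).real {ε : ℝ | r ≤ |ε|} ↔
      r / stdNormalQuantile (1 - α / 2) ≤ σ := by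
  have hmap : gaussianReal 0 (Real.toNNReal (σ ^ 2)) = (gaussianReal 0 1).map (σ * ·) := by
    rw [gaussianReal_map_const_mul, mul_zero, mul_one]
    congr 1
    ext
    simp [sq_nonneg]
  have hpre : (σ * ·) ⁻¹' {ε : ℝ | r ≤ |ε|} = {x : ℝ | r / σ ≤ |x|} := by
    ext x
    simp only [mem_preimage, mem_ofPred_eq, abs_mul, abs_of_pos hσ, div_le_iff₀ hσ, mul_comm]
  have hq := stdNormalQuantile_pos hα
  rw [hmap, map_measureReal_apply (by fun_prop) (measurableSet_le measurable_const (by fun_prop)),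
    hpre, real_le_abs gaussianReal_symm (div_pos hr hσ)]
  have hcdf : cdf (gaussianReal 0 1) (stdNormalQuantile (1 - α / 2)) = 1 - α / 2 :=
    cdf_quantile (by linarith [hα.2]) (by linarith [hα.1])
  rw [div_le_iff₀ hq, mul_comm σ, ← div_le_iff₀ hσ]
  have hiff := strictMono_cdf_gaussianReal.le_iff_le (a := r / σ)
    (b := stdNormalQuantile (1 - α / 2))
  rw [hcdf] at hiff
  rw [← hiff]
  constructor <;> intro h <;> linarith

theorem feasibleScales_eq {μ : Measure ℝ} {τ α : ℝ} (hR : 0 < tailRadius μ τ)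
    (hα : α ∈ Ioo (0 : ℝ) 1) :
    feasibleScales μ τ α = Ici (tailRadius μ τ / stdNormalQuantile (1 - α / 2)) := by
  ext σ
  have hpos := div_pos hR (stdNormalQuantile_pos hα)
  exact ⟨fun h => (gaussian_coverage_iff h.1 hR hα).1 h.2,
    fun h => ⟨hpos.trans_le h, (gaussian_coverage_iff (hpos.trans_le h) hR hα).2 h⟩⟩

theorem isLeast_feasibleScales {μ : Measure ℝ} {τ α : ℝ} (hR : 0 < tailRadius μ τ)
    (hα : α ∈ Ioo (0 : ℝ) 1) :
    IsLeast (feasibleScales μ τ α) (tailRadius μ τ / stdNormalQuantile (1 - α / 2)) := by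
  rw [feasibleScales_eq hR hα]
  exact isLeast_Ici

theorem map_neg_withDensity {p : ℝ → ℝ≥0∞} (hp : ∀ x, p (-x) = p x) :
    (volume.withDensity p).map (fun x => -x) = volume.withDensity p := by
  ext s hs
  rw [Measure.map_apply measurable_neg hs, withDensity_apply _ (measurable_neg hs),
    withDensity_apply _ hs]
  have := (Measure.measurePreserving_neg (volume : Measure ℝ)).setLIntegral_comp_preimage_emb
    (MeasurableEquiv.neg ℝ).measurableEmbedding p s
  simp only [hp] at this
  exact this

instance (p : ℝ → ℝ≥0∞) : NullSingletonClass (volume.withDensity p) :=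
  ⟨fun x => withDensity_absolutelyContinuous _ _ (measure_singleton x)⟩

theorem IsStdSymmUnimodal.tailRadius_pos {μ : Measure ℝ} (h : IsStdSymmUnimodal μ) {τ : ℝ}
    (hτ : τ ∈ Ioo (0 : ℝ) 1) : 0 < tailRadius μ τ := by
  obtain ⟨p, -, rfl, hsymm, -⟩ := h.exists_density
  have := h.isProbabilityMeasure
  exact quantile_pos_of_symm (map_neg_withDensity hsymm) (by linarith [hτ.2]) (by linarith [hτ.1])

end Coverage

/-! ### From ordered densities to ordered minimal scales -/

/-- Strict monotonicity makes the kurtosis injective on `I`, so the parameter, and with it the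
scale, is a function of the kurtosis. Two order reversals compose to an increasing map. -/
theorem minScaleStrictMonoInKurtosis {P : ℝ → Measure ℝ} {I : Set ℝ} {τ α : ℝ}
    (hα : α ∈ Ioo (0 : ℝ) 1) (hpos : ∀ θ ∈ I, 0 < tailRadius (P θ) τ)
    (hκ : StrictAntiOn (fun θ => kurtosis (P θ)) I)
    (hR : StrictAntiOn (fun θ => tailRadius (P θ) τ) I) :
    MinScaleStrictMonoInKurtosis P I τ α := by
  have hinv : ∀ θ ∈ I, Function.invFunOn (fun θ => kurtosis (P θ)) I (kurtosis (P θ)) = θ :=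
    fun θ hθ => hκ.injOn.leftInvOn_invFunOn hθ
  refine ⟨fun k => tailRadius (P (Function.invFunOn (fun θ => kurtosis (P θ)) I k)) τ /
    stdNormalQuantile (1 - α / 2), fun θ hθ => ?_, ?_⟩
  · beta_reduce
    rw [hinv θ hθ]
    exact isLeast_feasibleScales (hpos θ hθ) hα
  · rintro _ ⟨θ, hθ, rfl⟩ _ ⟨θ', hθ', rfl⟩ hlt
    simp only [hinv θ hθ, hinv θ' hθ']
    exact div_lt_div_of_pos_right (hR hθ' hθ ((hκ.lt_iff_gt hθ hθ').1 hlt))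
      (stdNormalQuantile_pos hα)

/-- If the densities are eventually ordered beyond a common point, then so are the tail radii, as
soon as they all lie beyond that point. -/
theorem strictAntiOn_tailRadius {f : ℝ → ℝ → ℝ} {P : ℝ → Measure ℝ} {I : Set ℝ} {τ x₀ : ℝ}
    (hP : ∀ θ ∈ I, P θ = volume.withDensity fun x => ENNReal.ofReal (f θ x))
    (hprob : ∀ θ ∈ I, IsProbabilityMeasure (P θ)) (hf : ∀ θ ∈ I, Measurable (f θ))
    (hf0 : ∀ θ ∈ I, ∀ x, 0 ≤ f θ x)
    (hlt : ∀ θ ∈ I, ∀ θ' ∈ I, θ < θ' → ∀ x, x₀ < x → f θ' x < f θ x)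
    (hτ0 : 0 < τ) (hτ1 : τ < 1) (hτ : ∀ θ ∈ I, τ / 2 < (P θ).real (Ioi x₀)) :
    (∀ θ ∈ I, x₀ < tailRadius (P θ) τ) ∧ StrictAntiOn (fun θ => tailRadius (P θ) τ) I := by
  have hlow : ∀ θ ∈ I, x₀ < tailRadius (P θ) τ := by
    intro θ hθ
    have := hprob θ hθ
    have h := hτ θ hθ
    rw [← one_sub_cdf] at h
    rw [tailRadius, ← not_le, quantile_le_iff (by linarith) (by linarith)]
    linarith
  refine ⟨hlow, fun θ hθ θ' hθ' hlt' => ?_⟩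
  have h1 := hprob θ hθ
  have h2 := hprob θ' hθ'
  have h3 : NullSingletonClass (P θ') := by rw [hP θ' hθ']; infer_instance
  set Q := tailRadius (P θ') τ with hQ
  have hcdf : cdf (P θ') Q = 1 - τ / 2 := cdf_quantile (by linarith) (by linarith)
  -- Strictness survives integration because the densities differ on all of `Ioi Q`, a set of
  -- positive Lebesgue measure.
  have htail : (P θ').real (Ioi Q) < (P θ).real (Ioi Q) := by
    refine (ENNReal.toReal_lt_toReal (measure_ne_top _ _) (measure_ne_top _ _)).2 ?_
    have hfin : P θ' (Ioi Q) ≠ ∞ := measure_ne_top _ _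
    rw [hP θ' hθ', withDensity_apply _ measurableSet_Ioi] at hfin ⊢
    rw [hP θ hθ, withDensity_apply _ measurableSet_Ioi]
    refine setLIntegral_strict_mono measurableSet_Ioi (by simp) (hf θ hθ).ennreal_ofReal hfin
      (ae_of_all _ fun x hx => ?_)
    have := hlt θ hθ θ' hθ' hlt' x ((hlow θ' hθ').trans hx)
    exact (ENNReal.ofReal_lt_ofReal_iff ((hf0 θ' hθ' x).trans_lt this)).2 this
  rw [← one_sub_cdf, ← one_sub_cdf] at htail
  change Q < quantile (P θ) (1 - τ / 2)
  rw [← not_le, quantile_le_iff (by linarith) (by linarith)]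
  linarith

/-! ### Moments of even densities -/

section EvenDensity

variable {f : ℝ → ℝ}

theorem integral_eq_two_mul_of_even {g : ℝ → ℝ} (hg : ∀ x, g (-x) = g x) :
    ∫ x, g x = 2 * ∫ x in Ioi (0 : ℝ), g x := by
  have : (fun x => g x) = fun x => g |x| := by
    ext x
    rcases abs_choice x with h | h <;> rw [h]
    rw [hg]
  rw [this, integral_comp_abs]
  congr 1
  exact setIntegral_congr_fun measurableSet_Ioi fun x hx => by simp only [abs_of_pos (mem_Ioi.1 hx)]

theorem isProbabilityMeasure_of_even (hf0 : ∀ x, 0 ≤ f x) (hfe : ∀ x, f (-x) = f x)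
    (hf1 : 2 * ∫ x in Ioi (0 : ℝ), f x = 1) :
    IsProbabilityMeasure (volume.withDensity fun x => ENNReal.ofReal (f x)) := by
  rw [← integral_eq_two_mul_of_even hfe] at hf1
  -- A non-integrable function has integral 0 by convention, so the value 1 forces integrability.
  have hint : Integrable f := by
    by_contra h
    rw [integral_undef h] at hf1
    exact zero_ne_one hf1
  constructor
  rw [withDensity_apply _ MeasurableSet.univ, Measure.restrict_univ,
    ← ofReal_integral_eq_lintegral_ofReal hint (ae_of_all _ hf0), hf1, ENNReal.ofReal_one]

theorem integral_withDensity_ofReal (hf : Measurable f) (hf0 : ∀ x, 0 ≤ f x) (g : ℝ → ℝ) :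
    ∫ x, g x ∂(volume.withDensity fun x => ENNReal.ofReal (f x)) = ∫ x, g x * f x := by
  rw [integral_withDensity_eq_integral_toReal_smul hf.ennreal_ofReal (ae_of_all _ fun x => by simp)]
  refine integral_congr_ae (ae_of_all _ fun x => ?_)
  simp only [ENNReal.toReal_ofReal (hf0 x), smul_eq_mul, mul_comm]

theorem kurtosis_of_even (hf : Measurable f) (hf0 : ∀ x, 0 ≤ f x) (hfe : ∀ x, f (-x) = f x) :
    kurtosis (volume.withDensity fun x => ENNReal.ofReal (f x)) =
      (2 * ∫ x in Ioi (0 : ℝ), x ^ 4 * f x) / (2 * ∫ x in Ioi (0 : ℝ), x ^ 2 * f x) ^ 2 := by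
  have hmean : ∫ x, id x ∂(volume.withDensity fun x => ENNReal.ofReal (f x)) = 0 := by
    rw [integral_withDensity_ofReal hf hf0]
    -- Reflection shows that the mean equals its own negative; this needs no integrability.
    have h := integral_neg_eq_self (fun x => id x * f x) volume
    simp only [hfe, id, neg_mul, integral_neg] at h ⊢
    linarith
  rw [kurtosis, variance_eq_integral measurable_id.aemeasurable, centralMoment, hmean]
  simp only [Pi.pow_apply, Pi.sub_apply, id, sub_zero]
  rw [integral_withDensity_ofReal hf hf0 (fun x => x ^ 4),
    integral_withDensity_ofReal hf hf0 (fun x => x ^ 2), integral_eq_two_mul_of_even,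
    integral_eq_two_mul_of_even]
  · intro x; rw [hfe]; ring
  · intro x; rw [hfe]; ring

end EvenDensity

/-! ### The generalised Gaussian family -/

section GeneralisedGaussian

theorem ggdScale_pos {β : ℝ} (hβ : 0 < β) : 0 < ggdScale β :=
  Real.sqrt_pos.2 (div_pos (Real.Gamma_pos_of_pos (by positivity))
    (Real.Gamma_pos_of_pos (by positivity)))

theorem measurable_ggdPDF (β a : ℝ) : Measurable (ggdPDF β a) := by
  unfold ggdPDF
  fun_prop

theorem ggdPDF_pos {β a : ℝ} (hβ : 0 < β) (ha : 0 < a) (x : ℝ) : 0 < ggdPDF β a x := by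
  have := Real.Gamma_pos_of_pos (one_div_pos.2 hβ)
  unfold ggdPDF
  positivity

theorem two_mul_integral_pow_mul_ggdPDF {β a : ℝ} (hβ : 0 < β) (ha : 0 < a) (k : ℕ) :
    2 * ∫ x in Ioi (0 : ℝ), x ^ k * ggdPDF β a x =
      a ^ k * Real.Gamma ((k + 1) / β) / Real.Gamma (1 / β) := by
  have hG := Real.Gamma_pos_of_pos (one_div_pos.2 hβ)
  have h1 : ∫ x in Ioi (0 : ℝ), x ^ k * ggdPDF β a x =
      ∫ x in Ioi (0 : ℝ), β / (2 * a * Real.Gamma (1 / β)) *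
        (x ^ (k : ℝ) * Real.exp (-a ^ (-β) * x ^ β)) := by
    refine setIntegral_congr_fun measurableSet_Ioi fun x hx => ?_
    have hx : 0 < x := hx
    simp only [ggdPDF, abs_of_pos hx, Real.rpow_natCast]
    rw [Real.div_rpow hx.le ha.le, Real.rpow_neg ha.le, neg_mul, div_eq_inv_mul (x ^ β)]
    ring
  have hk : (-1 : ℝ) < k := by have := Nat.cast_nonneg (α := ℝ) k; linarith
  rw [h1, integral_const_mul, integral_rpow_mul_exp_neg_mul_rpow hβ hk (by positivity),
    ← Real.rpow_mul ha.le]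
  have : -β * (-(k + 1) / β) = ((k + 1 : ℕ) : ℝ) := by push_cast; field_simp
  rw [this, Real.rpow_natCast, pow_succ]
  field_simp

theorem isProbabilityMeasure_ggd {β : ℝ} (hβ : 0 < β) : IsProbabilityMeasure (ggd β) := by
  have ha := ggdScale_pos hβ
  refine isProbabilityMeasure_of_even (fun x => (ggdPDF_pos hβ ha x).le)
    (fun x => by simp only [ggdPDF, abs_neg]) ?_
  have h := two_mul_integral_pow_mul_ggdPDF hβ ha 0
  simp only [pow_zero, one_mul, Nat.cast_zero, zero_add] at h
  rw [h, div_self (Real.Gamma_pos_of_pos (one_div_pos.2 hβ)).ne']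

/-- The scale cancels between a⁴ and (a²)². Multiples of 1/β are kept so that monotonicity can be
studied in t = 1/β. -/
theorem kurtosis_ggd {β : ℝ} (hβ : 0 < β) :
    kurtosis (ggd β) = Real.Gamma (5 * (1 / β)) * Real.Gamma (1 / β) /
      Real.Gamma (3 * (1 / β)) ^ 2 := by
  have ha := ggdScale_pos hβ
  have h1 := Real.Gamma_pos_of_pos (one_div_pos.2 hβ)
  have h3 : 0 < Real.Gamma (3 / β) := Real.Gamma_pos_of_pos (by positivity)
  rw [ggd, kurtosis_of_even (measurable_ggdPDF _ _) (fun x => (ggdPDF_pos hβ ha x).le)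
    (fun x => by simp only [ggdPDF, abs_neg]), two_mul_integral_pow_mul_ggdPDF hβ ha,
    two_mul_integral_pow_mul_ggdPDF hβ ha]
  norm_num
  norm_num at h1
  rw [← div_eq_mul_inv, ← div_eq_mul_inv]
  field_simp

/-- The ratio `Γ(5t)Γ(t)/Γ(3t)²` increases, by comparing the factors of Euler's products. -/
theorem strictMonoOn_gamma_ratio :
    StrictMonoOn (fun t => Real.Gamma (5 * t) * Real.Gamma t / Real.Gamma (3 * t) ^ 2) (Ioi 0) := by
  intro s hs t ht hst
  have hs : 0 < s := hs
  have ht : 0 < t := ht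
  set w : ℝ → ℕ → ℝ := fun u j => (3 * u + j) ^ 2 / ((5 * u + j) * (u + j)) with hw
  have hwpos : ∀ u, 0 < u → ∀ j, 0 < w u j := fun u hu j => by simp only [hw]; positivity
  have hdiff : ∀ j : ℕ, w t j - w s j =
      4 * j * (t - s) * (6 * s * t + j * (s + t)) /
        ((5 * t + j) * (t + j) * ((5 * s + j) * (s + j))) := by
    intro j
    simp only [hw]
    rw [div_sub_div _ _ (by positivity) (by positivity)]
    congr 1
    ring
  have hmono : ∀ j, w s j ≤ w t j := fun j => by
    rw [← sub_nonneg, hdiff]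
    have := sub_pos.2 hst
    positivity
  -- The factor j = 0 is constantly 9/5, so strictness has to come from j = 1.
  have hone : w s 1 < w t 1 := by
    rw [← sub_pos, hdiff]
    have := sub_pos.2 hst
    positivity
  have hseq : ∀ u, 0 < u → ∀ n : ℕ, 1 ≤ n →
      Real.GammaSeq (5 * u) n * Real.GammaSeq u n / Real.GammaSeq (3 * u) n ^ 2 =
        ∏ j ∈ Finset.range (n + 1), w u j := by
    intro u hu n hn
    have hn' : (0 : ℝ) < n := by exact_mod_cast hn
    simp only [Real.GammaSeq, hw, Finset.prod_div_distrib, Finset.prod_pow, Finset.prod_mul_distrib]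
    have h5 : 0 < ∏ j ∈ Finset.range (n + 1), (5 * u + j) :=
      Finset.prod_pos fun j _ => by positivity
    have h1 : 0 < ∏ j ∈ Finset.range (n + 1), (u + j) :=
      Finset.prod_pos fun j _ => by positivity
    have h3 : 0 < ∏ j ∈ Finset.range (n + 1), (3 * u + j) :=
      Finset.prod_pos fun j _ => by positivity
    -- The powers of n cancel because 5 + 1 = 2 · 3.
    have hpow : (n : ℝ) ^ (5 * u) * (n : ℝ) ^ u = ((n : ℝ) ^ (3 * u)) ^ 2 := by
      rw [← Real.rpow_add hn', ← Real.rpow_mul_natCast hn'.le]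
      congr 1
      push_cast
      ring
    have h3p : 0 < (n : ℝ) ^ (3 * u) := by positivity
    have hf : (0 : ℝ) < (n.factorial : ℝ) := by exact_mod_cast n.factorial_pos
    rw [div_mul_div_comm, mul_mul_mul_comm, hpow]
    field_simp
  -- A limit would lose a strict inequality. Cross-multiplying by the factors at j = 1 keeps their
  -- strict gap outside the limit.
  have hprod : ∀ n : ℕ, 1 ≤ n → w t 1 * ∏ j ∈ Finset.range (n + 1), w s j ≤
      w s 1 * ∏ j ∈ Finset.range (n + 1), w t j := by
    intro n hn
    have h1 : 1 ∈ Finset.range (n + 1) := by simp; omega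
    rw [← Finset.mul_prod_erase _ _ h1, ← Finset.mul_prod_erase _ (w t) h1]
    have := Finset.prod_le_prod (s := (Finset.range (n + 1)).erase 1)
      (fun j _ => (hwpos s hs j).le) (fun j _ => hmono j)
    nlinarith [mul_le_mul_of_nonneg_left this (mul_pos (hwpos s hs 1) (hwpos t ht 1)).le]
  have hlim : ∀ u, 0 < u → Tendsto (fun n => ∏ j ∈ Finset.range (n + 1), w u j) atTop
      (𝓝 (Real.Gamma (5 * u) * Real.Gamma u / Real.Gamma (3 * u) ^ 2)) := by
    intro u hu
    have h := ((Real.GammaSeq_tendsto_Gamma (5 * u)).mul (Real.GammaSeq_tendsto_Gamma u)).div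
      ((Real.GammaSeq_tendsto_Gamma (3 * u)).pow 2)
      (pow_pos (Real.Gamma_pos_of_pos (by positivity)) 2).ne'
    refine h.congr' ?_
    filter_upwards [eventually_ge_atTop 1] with n hn using hseq u hu n hn
  have hle := le_of_tendsto_of_tendsto ((hlim s hs).const_mul (w t 1))
    ((hlim t ht).const_mul (w s 1))
    (by filter_upwards [eventually_ge_atTop 1] with n hn using hprod n hn)
  have hpos : 0 < Real.Gamma (5 * s) * Real.Gamma s / Real.Gamma (3 * s) ^ 2 := by
    have := Real.Gamma_pos_of_pos (show 0 < 5 * s by positivity)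
    have := Real.Gamma_pos_of_pos (show 0 < 3 * s by positivity)
    have := Real.Gamma_pos_of_pos hs
    positivity
  simp only
  nlinarith [mul_lt_mul_of_pos_right hone hpos, hwpos s hs 1]

theorem strictAntiOn_kurtosis_ggd : StrictAntiOn (fun β => kurtosis (ggd β)) (Ioi 0) := by
  intro β hβ γ hγ hlt
  simp only [kurtosis_ggd (mem_Ioi.1 hβ), kurtosis_ggd (mem_Ioi.1 hγ)]
  exact strictMonoOn_gamma_ratio (one_div_pos.2 (mem_Ioi.1 hγ)) (one_div_pos.2 (mem_Ioi.1 hβ))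
    (one_div_lt_one_div_of_lt hβ hlt)

theorem contDiffAt_Gamma {x : ℝ} (hx : 0 < x) : ContDiffAt ℝ 1 Real.Gamma x := by
  have hopen : IsOpen {z : ℂ | 0 < z.re} := isOpen_lt continuous_const Complex.continuous_re
  have hd : DifferentiableOn ℂ Complex.Gamma {z : ℂ | 0 < z.re} := fun z hz =>
    (Complex.differentiableAt_Gamma z fun m h => by
      rw [h] at hz
      simp only [mem_ofPred_eq, Complex.neg_re, Complex.natCast_re] at hz
      have := Nat.cast_nonneg (α := ℝ) m
      linarith).differentiableWithinAt
  have hc : ContDiffAt ℂ 1 Complex.Gamma (x : ℂ) :=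
    (hd.analyticAt (hopen.mem_nhds (by simpa using hx))).contDiffAt
  exact hc.real_of_complex

theorem contDiffAt_ggdScale {β : ℝ} (hβ : 0 < β) : ContDiffAt ℝ 1 ggdScale β := by
  have hG : ∀ c : ℝ, 0 < c → ContDiffAt ℝ 1 (fun b => Real.Gamma (c / b)) β := fun c hc =>
    (contDiffAt_Gamma (div_pos hc hβ)).comp β (contDiffAt_const.div contDiffAt_id hβ.ne')
  have h1 := Real.Gamma_pos_of_pos (one_div_pos.2 hβ)
  have h3 : 0 < Real.Gamma (3 / β) := Real.Gamma_pos_of_pos (by positivity)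
  exact ((hG 1 one_pos).div (hG 3 three_pos) h3.ne').sqrt (div_pos h1 h3).ne'

/-- A bound proportional to γ - β is what makes the threshold uniform over pairs of shapes that are
arbitrarily close. -/
theorem exists_abs_sub_le_of_contDiffAt {g : ℝ → ℝ} {b₀ b₁ : ℝ} (hb₀ : 0 < b₀)
    (hg : ∀ β, 0 < β → ContDiffAt ℝ 1 g β) :
    ∃ K : ℝ, 0 ≤ K ∧ ∀ β ∈ Icc b₀ b₁, ∀ γ ∈ Icc b₀ b₁, β ≤ γ → |g γ - g β| ≤ K * (γ - β) := by
  obtain ⟨K, hK⟩ := ContDiffOn.exists_lipschitzOnWith (f := g) (s := Icc b₀ b₁) (n := 1)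
    (fun β hβ => (hg β (hb₀.trans_le hβ.1)).contDiffWithinAt) one_ne_zero (convex_Icc _ _)
    isCompact_Icc
  refine ⟨K, K.2, fun β hβ γ hγ hle => ?_⟩
  have := hK.dist_le_mul γ hγ β hβ
  rwa [Real.dist_eq, Real.dist_eq, abs_of_nonneg (sub_nonneg.2 hle)] at this

theorem log_ggdPDF {β : ℝ} (hβ : 0 < β) {x : ℝ} (hx : 0 < x) :
    Real.log (ggdPDF β (ggdScale β) x) =
      Real.log (β / (2 * ggdScale β * Real.Gamma (1 / β))) -
        Real.exp (β * Real.log x - β * Real.log (ggdScale β)) := by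
  have ha := ggdScale_pos hβ
  have hG := Real.Gamma_pos_of_pos (one_div_pos.2 hβ)
  rw [ggdPDF, Real.log_mul (by positivity) (Real.exp_pos _).ne', Real.log_exp, abs_of_pos hx,
    Real.rpow_def_of_pos (div_pos hx ha), Real.log_div hx.ne' ha.ne', ← sub_eq_add_neg]
  congr 2
  ring

/-- On a compact range of shapes, the densities are strictly decreasing in the shape beyond a
common point. -/
theorem exists_forall_ggdPDF_lt {b₀ b₁ : ℝ} (hb₀ : 0 < b₀) :
    ∃ x₀ : ℝ, 0 < x₀ ∧ ∀ β ∈ Icc b₀ b₁, ∀ γ ∈ Icc b₀ b₁, β < γ → ∀ x, x₀ < x →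
      ggdPDF γ (ggdScale γ) x < ggdPDF β (ggdScale β) x := by
  obtain ⟨K, hK0, hK⟩ := exists_abs_sub_le_of_contDiffAt (b₁ := b₁) hb₀
    (g := fun β => Real.log (β / (2 * ggdScale β * Real.Gamma (1 / β)))) fun β hβ => by
      have ha := ggdScale_pos hβ
      have hG := Real.Gamma_pos_of_pos (one_div_pos.2 hβ)
      exact ContDiffAt.log (contDiffAt_id.div ((contDiffAt_const.mul (contDiffAt_ggdScale hβ)).mul
        ((contDiffAt_Gamma (one_div_pos.2 hβ)).comp β
          (contDiffAt_const.div contDiffAt_id hβ.ne'))) (by positivity)) (div_pos hβ (by positivity)).ne'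
  obtain ⟨M, hM0, hM⟩ := exists_abs_sub_le_of_contDiffAt (b₁ := b₁) hb₀
    (g := fun β => β * Real.log (ggdScale β)) fun β hβ =>
      contDiffAt_id.mul ((contDiffAt_ggdScale hβ).log (ggdScale_pos hβ).ne')
  obtain ⟨A, hA⟩ : ∃ A : ℝ, ∀ β ∈ Icc b₀ b₁, Real.log (ggdScale β) ≤ A := by
    have hc : ContinuousOn (fun β => Real.log (ggdScale β)) (Icc b₀ b₁) := fun β hβ =>
      have hβ := hb₀.trans_le hβ.1
      ((contDiffAt_ggdScale hβ).continuousAt.log (ggdScale_pos hβ).ne').continuousWithinAt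
    obtain ⟨A, hA⟩ := isCompact_Icc.bddAbove_image hc
    exact ⟨A, fun β hβ => hA ⟨β, hβ, rfl⟩⟩
  -- Beyond A the exponent e is nonnegative; beyond M + K its growth in the shape exceeds the
  -- variation K(γ - β) of the log constant.
  refine ⟨Real.exp (max A (M + K)), Real.exp_pos _, fun β hβ γ hγ hlt x hx => ?_⟩
  have hβ0 := hb₀.trans_le hβ.1
  have hγ0 := hb₀.trans_le hγ.1
  have hx0 : 0 < x := (Real.exp_pos _).trans hx
  have hl : max A (M + K) < Real.log x := (Real.lt_log_iff_exp_lt hx0).2 hx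
  have hlA : A < Real.log x := (le_max_left _ _).trans_lt hl
  have hlM : M + K < Real.log x := (le_max_right _ _).trans_lt hl
  rw [← Real.log_lt_log_iff (ggdPDF_pos hγ0 (ggdScale_pos hγ0) x)
    (ggdPDF_pos hβ0 (ggdScale_pos hβ0) x), log_ggdPDF hβ0 hx0, log_ggdPDF hγ0 hx0]
  have h1 := (abs_le.1 (hK β hβ γ hγ hlt.le)).2
  have h2 := (abs_le.1 (hM β hβ γ hγ hlt.le)).2
  set e := β * Real.log x - β * Real.log (ggdScale β) with he
  set e' := γ * Real.log x - γ * Real.log (ggdScale γ) with he'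
  have he0 : 0 ≤ e := by
    have := hA β hβ
    rw [he, ← mul_sub]
    exact mul_nonneg hβ0.le (by linarith)
  have hd : 0 < γ - β := sub_pos.2 hlt
  have hee : (Real.log x - M) * (γ - β) ≤ e' - e := by
    rw [he, he']
    linarith
  have hgap : K * (γ - β) < (Real.log x - M) * (γ - β) :=
    mul_lt_mul_of_pos_right (by linarith) hd
  have hee0 : 0 ≤ e' - e := (mul_nonneg hK0 hd.le).trans (hgap.le.trans hee)
  have hexp : e' - e ≤ Real.exp e' - Real.exp e := by
    have h3 : Real.exp e' = Real.exp e * Real.exp (e' - e) := by rw [← Real.exp_add]; congr 1; ring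
    have h4 := Real.add_one_le_exp (e' - e)
    have h5 := Real.one_le_exp he0
    rw [h3]
    nlinarith
  linarith

theorem minScaleStrictMonoInKurtosis_ggd {b₀ b₁ : ℝ} (hb₀ : 0 < b₀) (hb : b₀ ≤ b₁) :
    ∃ τGGD : ℝ, 0 < τGGD ∧ ∀ τ ∈ Ioo (0 : ℝ) τGGD, ∀ α ∈ Ioo (0 : ℝ) 1,
      MinScaleStrictMonoInKurtosis ggd (Icc b₀ b₁) τ α := by
  obtain ⟨x₀, hx₀, hlt⟩ := exists_forall_ggdPDF_lt (b₁ := b₁) hb₀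
  have hpos : ∀ β ∈ Icc b₀ b₁, 0 < β := fun β hβ => hb₀.trans_le hβ.1
  have hprob : ∀ β ∈ Icc b₀ b₁, IsProbabilityMeasure (ggd β) := fun β hβ =>
    isProbabilityMeasure_ggd (hpos β hβ)
  have hb₁ : b₁ ∈ Icc b₀ b₁ := ⟨hb, le_rfl⟩
  have hp1 := hprob b₁ hb₁
  have htail : 0 < (ggd b₁).real (Ioi x₀) := by
    refine lt_of_le_of_ne measureReal_nonneg (Ne.symm ?_)
    rw [measureReal_ne_zero_iff, ggd, withDensity_apply _ measurableSet_Ioi]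
    refine ((setLIntegral_pos_iff (measurable_ggdPDF _ _).ennreal_ofReal).2 ?_).ne'
    have : Function.support (fun x => ENNReal.ofReal (ggdPDF b₁ (ggdScale b₁) x)) = univ := by
      ext x
      simpa using ggdPDF_pos (hpos b₁ hb₁) (ggdScale_pos (hpos b₁ hb₁)) x
    rw [this, univ_inter, Real.volume_Ioi]
    exact ENNReal.zero_lt_top
  -- The largest shape has the lightest tail beyond x₀, so its tail mass serves the whole interval.
  have hmin : ∀ β ∈ Icc b₀ b₁, (ggd b₁).real (Ioi x₀) ≤ (ggd β).real (Ioi x₀) := by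
    intro β hβ
    have := hprob β hβ
    rcases hβ.2.eq_or_lt with h | h
    · rw [h]
    refine (ENNReal.toReal_le_toReal (measure_ne_top _ _) (measure_ne_top _ _)).2 ?_
    rw [ggd, ggd, withDensity_apply _ measurableSet_Ioi, withDensity_apply _ measurableSet_Ioi]
    exact setLIntegral_mono (measurable_ggdPDF _ _).ennreal_ofReal fun x hx =>
      ENNReal.ofReal_le_ofReal (hlt β hβ b₁ hb₁ h x hx).le
  refine ⟨min 1 (2 * (ggd b₁).real (Ioi x₀)), by positivity, fun τ hτ α hα => ?_⟩
  have hτ1 := hτ.2.trans_le (min_le_left _ _)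
  have hτ2 := hτ.2.trans_le (min_le_right _ _)
  obtain ⟨hlow, hR⟩ := strictAntiOn_tailRadius (f := fun β => ggdPDF β (ggdScale β)) (P := ggd)
    (I := Icc b₀ b₁) (τ := τ) (x₀ := x₀) (fun β _ => rfl) hprob (fun β _ => measurable_ggdPDF _ _)
    (fun β hβ x => (ggdPDF_pos (hpos β hβ) (ggdScale_pos (hpos β hβ)) x).le) hlt hτ.1 hτ1
    (fun β hβ => by linarith [hmin β hβ])
  exact minScaleStrictMonoInKurtosis hα (fun β hβ => hx₀.trans (hlow β hβ))
    (strictAntiOn_kurtosis_ggd.mono hpos) hR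

end GeneralisedGaussian

/-! ### The Student family: moments and kurtosis -/

section Student

/-- A nonzero Bochner integral already certifies integrability. The passage to `lintegral` lets
Tonelli swap the integrals below with measurability alone. -/
theorem lintegral_Ioi_ofReal_of_integral_eq {g : ℝ → ℝ} {v : ℝ} (hg : ∀ x, 0 < x → 0 ≤ g x)
    (hv : 0 < v) (h : ∫ x in Ioi (0 : ℝ), g x = v) :
    ∫⁻ x in Ioi (0 : ℝ), ENNReal.ofReal (g x) = ENNReal.ofReal v := by
  have hint : Integrable g (volume.restrict (Ioi 0)) := by
    by_contra hn
    rw [integral_undef hn] at h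
    exact hv.ne h
  rw [← h, ofReal_integral_eq_lintegral_ofReal hint]
  exact (ae_restrict_iff' measurableSet_Ioi).2 (ae_of_all _ hg)

/-- The moments of the kernel `(1 + x²/m)^(-p)`, by integrating the Gamma integral of
`(1 + x²/m)^(-p)` in the other order. -/
theorem integral_pow_mul_one_add_sq_div_rpow {m p : ℝ} (hm : 0 < m) (k : ℕ)
    (hp : ((k : ℝ) + 1) / 2 < p) :
    ∫ x in Ioi (0 : ℝ), x ^ k * (1 + x ^ 2 / m) ^ (-p) =
      m ^ (((k : ℝ) + 1) / 2) * Real.Gamma ((k + 1) / 2) * Real.Gamma (p - (k + 1) / 2) /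
        (2 * Real.Gamma p) := by
  have hk0 : (0 : ℝ) ≤ k := Nat.cast_nonneg k
  have hp0 : 0 < p := lt_trans (by positivity) hp
  have hG1 : 0 < Real.Gamma (((k : ℝ) + 1) / 2) := Real.Gamma_pos_of_pos (by positivity)
  have hG2 : 0 < Real.Gamma (p - ((k : ℝ) + 1) / 2) := Real.Gamma_pos_of_pos (by linarith)
  have hGp := Real.Gamma_pos_of_pos hp0
  set F : ℝ → ℝ → ℝ := fun x t => x ^ k * (t ^ (p - 1) * Real.exp (-((1 + x ^ 2 / m) * t))) with hF
  have hFt : ∀ x, 0 < x → ∫⁻ t in Ioi (0 : ℝ), ENNReal.ofReal (F x t) =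
      ENNReal.ofReal (Real.Gamma p * (x ^ k * (1 + x ^ 2 / m) ^ (-p))) := by
    intro x hx
    have hr : 0 < 1 + x ^ 2 / m := by positivity
    refine lintegral_Ioi_ofReal_of_integral_eq (fun t ht => by positivity) (by positivity) ?_
    simp only [hF]
    rw [integral_const_mul, Real.integral_rpow_mul_exp_neg_mul_Ioi hp0 hr, one_div,
      Real.inv_rpow hr.le, ← Real.rpow_neg hr.le]
    ring
  have hFx : ∀ t, 0 < t → ∫⁻ x in Ioi (0 : ℝ), ENNReal.ofReal (F x t) =
      ENNReal.ofReal (m ^ (((k : ℝ) + 1) / 2) * Real.Gamma ((k + 1) / 2) / 2 *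
        (t ^ (p - (k + 1) / 2 - 1) * Real.exp (-(1 * t)))) := by
    intro t ht
    refine lintegral_Ioi_ofReal_of_integral_eq (fun x hx => by positivity) (by positivity) ?_
    have h1 : ∀ x, F x t = t ^ (p - 1) * Real.exp (-t) *
        (x ^ (k : ℝ) * Real.exp (-(t / m) * x ^ (2 : ℝ))) := by
      intro x
      have : -((1 + x ^ 2 / m) * t) = -t + -(t / m) * x ^ 2 := by ring
      simp only [hF]
      rw [this, Real.exp_add, Real.rpow_natCast, Real.rpow_two]
      ring
    simp_rw [h1]
    rw [integral_const_mul, integral_rpow_mul_exp_neg_mul_rpow two_pos (by linarith)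
      (div_pos ht hm), neg_div, Real.rpow_neg (by positivity), Real.div_rpow ht.le hm.le, inv_div,
      show p - ((k : ℝ) + 1) / 2 - 1 = (p - 1) - (k + 1) / 2 by ring,
      Real.rpow_sub ht (p - 1), one_mul]
    ring
  have hswap : ∫⁻ x in Ioi (0 : ℝ), ∫⁻ t in Ioi (0 : ℝ), ENNReal.ofReal (F x t) =
      ∫⁻ t in Ioi (0 : ℝ), ∫⁻ x in Ioi (0 : ℝ), ENNReal.ofReal (F x t) := by
    refine lintegral_lintegral_swap (Measurable.aemeasurable ?_)
    simp only [hF, Function.uncurry_def]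
    fun_prop
  have hlast : ∫⁻ t in Ioi (0 : ℝ), ENNReal.ofReal (m ^ (((k : ℝ) + 1) / 2) *
      Real.Gamma ((k + 1) / 2) / 2 * (t ^ (p - (k + 1) / 2 - 1) * Real.exp (-(1 * t)))) =
      ENNReal.ofReal (m ^ (((k : ℝ) + 1) / 2) * Real.Gamma ((k + 1) / 2) / 2 *
        Real.Gamma (p - (k + 1) / 2)) := by
    refine lintegral_Ioi_ofReal_of_integral_eq (fun t ht => by positivity) (by positivity) ?_
    rw [integral_const_mul, Real.integral_rpow_mul_exp_neg_mul_Ioi (by linarith) one_pos]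
    simp
  rw [setLIntegral_congr_fun measurableSet_Ioi hFt, setLIntegral_congr_fun measurableSet_Ioi hFx,
    hlast] at hswap
  have hval : ∫ x in Ioi (0 : ℝ), Real.Gamma p * (x ^ k * (1 + x ^ 2 / m) ^ (-p)) =
      m ^ (((k : ℝ) + 1) / 2) * Real.Gamma ((k + 1) / 2) / 2 * Real.Gamma (p - (k + 1) / 2) := by
    rw [integral_eq_lintegral_of_nonneg_ae, hswap, ENNReal.toReal_ofReal (by positivity)]
    · refine (ae_restrict_iff' measurableSet_Ioi).2 (ae_of_all _ fun x hx => ?_)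
      have hx : 0 < x := hx
      simp only [Pi.zero_apply]
      positivity
    · exact Measurable.aestronglyMeasurable (by fun_prop)
  rw [integral_const_mul] at hval
  rw [eq_div_iff (by positivity)]
  linear_combination 2 * hval

/-- The density at `0` of the unit-variance Student law. -/
def studentConst (ν : ℝ) : ℝ :=
  Real.Gamma ((ν + 1) / 2) / (√(Real.pi * (ν - 2)) * Real.Gamma (ν / 2))

theorem studentConst_pos {ν : ℝ} (hν : 2 < ν) : 0 < studentConst ν := by
  have h1 : 0 < Real.Gamma ((ν + 1) / 2) := Real.Gamma_pos_of_pos (by linarith)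
  have h2 : 0 < Real.Gamma (ν / 2) := Real.Gamma_pos_of_pos (by linarith)
  have h3 : 0 < ν - 2 := by linarith
  have := Real.pi_pos
  unfold studentConst
  positivity

theorem studentPDF_eq {ν : ℝ} (hν : 2 < ν) (x : ℝ) :
    studentPDF ν (√((ν - 2) / ν)) x =
      studentConst ν * (1 + x ^ 2 / (ν - 2)) ^ (-((ν + 1) / 2)) := by
  have h0 : 0 < ν := by linarith
  have h3 : 0 < ν - 2 := by linarith
  have hpi := Real.pi_pos
  rw [studentPDF, studentConst, div_pow, Real.sq_sqrt (by positivity)]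
  have hs : √(ν * Real.pi) * √((ν - 2) / ν) = √(Real.pi * (ν - 2)) := by
    rw [← Real.sqrt_mul (by positivity)]
    congr 1
    field_simp
  have hx : x ^ 2 / ((ν - 2) / ν) / ν = x ^ 2 / (ν - 2) := by field_simp
  rw [hx, mul_right_comm, hs]

theorem studentPDF_pos {ν : ℝ} (hν : 2 < ν) (x : ℝ) : 0 < studentPDF ν (√((ν - 2) / ν)) x := by
  rw [studentPDF_eq hν]
  have h3 : 0 < ν - 2 := by linarith
  exact mul_pos (studentConst_pos hν) (by positivity)

theorem measurable_studentPDF (ν s : ℝ) : Measurable (studentPDF ν s) := by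
  unfold studentPDF
  fun_prop

theorem studentPDF_neg (ν s x : ℝ) : studentPDF ν s (-x) = studentPDF ν s x := by
  simp only [studentPDF, neg_div, neg_sq]

theorem two_mul_integral_pow_mul_studentPDF {ν : ℝ} (hν : 2 < ν) (k : ℕ) (hk : (k : ℝ) < ν) :
    2 * ∫ x in Ioi (0 : ℝ), x ^ k * studentPDF ν (√((ν - 2) / ν)) x =
      (ν - 2) ^ ((k : ℝ) / 2) * Real.Gamma ((k + 1) / 2) * Real.Gamma ((ν - k) / 2) /
        (√Real.pi * Real.Gamma (ν / 2)) := by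
  have h3 : 0 < ν - 2 := by linarith
  have hG1 : 0 < Real.Gamma ((ν + 1) / 2) := Real.Gamma_pos_of_pos (by linarith)
  have hG2 : 0 < Real.Gamma (ν / 2) := Real.Gamma_pos_of_pos (by linarith)
  have hpi := Real.pi_pos
  simp_rw [studentPDF_eq hν, mul_left_comm _ (studentConst ν)]
  rw [integral_const_mul, integral_pow_mul_one_add_sq_div_rpow h3 k (by linarith), studentConst,
    Real.sqrt_mul hpi.le, show ((k : ℝ) + 1) / 2 = k / 2 + 1 / 2 by ring, Real.rpow_add h3,
    ← Real.sqrt_eq_rpow, show (ν + 1) / 2 - ((k : ℝ) / 2 + 1 / 2) = (ν - k) / 2 by ring]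
  have := Real.sqrt_pos.2 h3
  field_simp

theorem isProbabilityMeasure_stdStudent {ν : ℝ} (hν : 2 < ν) :
    IsProbabilityMeasure (stdStudent ν) := by
  refine isProbabilityMeasure_of_even (fun x => (studentPDF_pos hν x).le)
    (fun x => studentPDF_neg _ _ x) ?_
  have h := two_mul_integral_pow_mul_studentPDF hν 0 (by simp; linarith)
  simp only [pow_zero, one_mul, Nat.cast_zero, zero_add, sub_zero, zero_div, Real.rpow_zero,
    Real.Gamma_one_half_eq] at h
  have hG2 : 0 < Real.Gamma (ν / 2) := Real.Gamma_pos_of_pos (by linarith)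
  rw [h, div_self]
  have := Real.pi_pos
  positivity

/-- The recurrence Γ(s+1) = sΓ(s) reduces every Gamma value containing ν to Γ((ν-4)/2), which
cancels. -/
theorem kurtosis_stdStudent {ν : ℝ} (hν : 4 < ν) :
    kurtosis (stdStudent ν) = 3 * (ν - 2) / (ν - 4) := by
  have hν2 : 2 < ν := by linarith
  have h2 : 0 < ν - 2 := by linarith
  have h4 : 0 < ν - 4 := by linarith
  have hpi := Real.sqrt_pos.2 Real.pi_pos
  rw [stdStudent, kurtosis_of_even (measurable_studentPDF _ _) (fun x => (studentPDF_pos hν2 x).le)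
    (fun x => studentPDF_neg _ _ x),
    two_mul_integral_pow_mul_studentPDF hν2 2 (by push_cast; linarith),
    two_mul_integral_pow_mul_studentPDF hν2 4 (by push_cast; linarith)]
  have g3 : Real.Gamma (((2 : ℕ) + 1 : ℝ) / 2) = √Real.pi / 2 := by
    rw [show ((2 : ℕ) + 1 : ℝ) / 2 = 1 / 2 + 1 by norm_num, Real.Gamma_add_one (by norm_num),
      Real.Gamma_one_half_eq]
    ring
  have g5 : Real.Gamma (((4 : ℕ) + 1 : ℝ) / 2) = 3 * √Real.pi / 4 := by
    rw [show ((4 : ℕ) + 1 : ℝ) / 2 = (1 / 2 + 1) + 1 by norm_num, Real.Gamma_add_one (by norm_num),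
      Real.Gamma_add_one (by norm_num), Real.Gamma_one_half_eq]
    ring
  have hG : 0 < Real.Gamma ((ν - 4) / 2) := Real.Gamma_pos_of_pos (by linarith)
  have e2 : Real.Gamma ((ν - (2 : ℕ)) / 2) = (ν - 4) / 2 * Real.Gamma ((ν - 4) / 2) := by
    rw [← Real.Gamma_add_one (by linarith)]
    congr 1
    push_cast
    ring
  have e0 : Real.Gamma (ν / 2) = (ν - 2) / 2 * ((ν - 4) / 2 * Real.Gamma ((ν - 4) / 2)) := by
    have h := Real.Gamma_add_one (s := (ν - 2) / 2) (by linarith)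
    rw [show (ν - 2) / 2 + 1 = ν / 2 by ring] at h
    rw [← e2, h]
    norm_num
  have p2 : (ν - 2) ^ (((2 : ℕ) : ℝ) / 2) = ν - 2 := by norm_num
  have p4 : (ν - 2) ^ (((4 : ℕ) : ℝ) / 2) = (ν - 2) ^ 2 := by
    rw [show ((4 : ℕ) : ℝ) / 2 = (2 : ℕ) by norm_num, Real.rpow_natCast]
  have c4 : Real.Gamma ((ν - (4 : ℕ)) / 2) = Real.Gamma ((ν - 4) / 2) := by norm_num
  rw [g3, g5, e2, e0, p2, p4, c4]
  field_simp
  norm_num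

theorem strictAntiOn_kurtosis_stdStudent :
    StrictAntiOn (fun ν => kurtosis (stdStudent ν)) (Ioi 4) := by
  intro ν hν ν' hν' hlt
  have hν : 4 < ν := hν
  have hν' : 4 < ν' := hν'
  simp only [kurtosis_stdStudent hν, kurtosis_stdStudent hν']
  rw [div_lt_div_iff₀ (by linarith) (by linarith)]
  nlinarith

/-! ### Log-convexity of Gamma and monotonicity of the Student constant -/

theorem sq_Gamma_midpoint_le {a b : ℝ} (ha : 0 < a) (hb : 0 < b) :
    Real.Gamma ((a + b) / 2) ^ 2 ≤ Real.Gamma a * Real.Gamma b := by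
  have h := Real.Gamma_mul_add_mul_le_rpow_Gamma_mul_rpow_Gamma ha hb one_half_pos one_half_pos
    (by norm_num)
  rw [← Real.sqrt_eq_rpow, ← Real.sqrt_eq_rpow, ← Real.sqrt_mul (Real.Gamma_pos_of_pos ha).le,
    show (1 / 2 : ℝ) * a + 1 / 2 * b = (a + b) / 2 by ring] at h
  have h0 := Real.Gamma_pos_of_pos (show 0 < (a + b) / 2 by positivity)
  have := mul_pos (Real.Gamma_pos_of_pos ha) (Real.Gamma_pos_of_pos hb)
  exact (Real.le_sqrt h0.le this.le).1 h

/-- `Γ(x + 1/2)² / ((x - 1) Γ(x)²)`, a multiple of the squared density at `0` of the unit-variance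
Student law with `2x` degrees of freedom. -/
def gammaHalfRatio (x : ℝ) : ℝ :=
  Real.Gamma (x + 1 / 2) ^ 2 / ((x - 1) * Real.Gamma x ^ 2)

/-- Log-convexity at x ± 1/2 bounds the ratio below by (x - 1/2)/(x - 1). -/
theorem one_le_gammaHalfRatio {x : ℝ} (hx : 1 < x) : 1 ≤ gammaHalfRatio x := by
  have hG := Real.Gamma_pos_of_pos (show 0 < x by linarith)
  have hG' := Real.Gamma_pos_of_pos (show 0 < x - 1 / 2 by linarith)
  have h := sq_Gamma_midpoint_le (show 0 < x - 1 / 2 by linarith) (show 0 < x + 1 / 2 by linarith)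
  have e : Real.Gamma (x + 1 / 2) = (x - 1 / 2) * Real.Gamma (x - 1 / 2) := by
    rw [← Real.Gamma_add_one (by linarith)]
    congr 1
    ring
  have hx1 : 0 < x - 1 := by linarith
  rw [show (x - 1 / 2 + (x + 1 / 2)) / 2 = x by ring, e] at h
  rw [gammaHalfRatio, one_le_div (by positivity), e]
  nlinarith [mul_le_mul_of_nonneg_left h hx1.le, sq_nonneg (Real.Gamma (x - 1 / 2)),
    mul_nonneg (sq_nonneg (Real.Gamma (x - 1 / 2))) (show 0 ≤ x - 1 / 2 by linarith)]

theorem gammaHalfRatio_le {x : ℝ} (hx : 1 < x) : gammaHalfRatio x ≤ x / (x - 1) := by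
  have hG := Real.Gamma_pos_of_pos (show 0 < x by linarith)
  have h := sq_Gamma_midpoint_le (show 0 < x by linarith) (show 0 < x + 1 by linarith)
  have hx1 : 0 < x - 1 := by linarith
  rw [show (x + (x + 1)) / 2 = x + 1 / 2 by ring, Real.Gamma_add_one (by linarith)] at h
  rw [gammaHalfRatio, div_le_div_iff₀ (by positivity) hx1]
  nlinarith [mul_le_mul_of_nonneg_left h hx1.le]

theorem gammaHalfRatio_add_one {x : ℝ} (hx : 1 < x) :
    gammaHalfRatio (x + 1) = (1 - 3 / (4 * x ^ 2) - 1 / (4 * x ^ 3)) * gammaHalfRatio x := by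
  have hx0 : 0 < x := by linarith
  have hG := Real.Gamma_pos_of_pos hx0
  have hx1 : 0 < x - 1 := by linarith
  rw [gammaHalfRatio, gammaHalfRatio, show x + 1 + 1 / 2 = (x + 1 / 2) + 1 by ring,
    Real.Gamma_add_one (by linarith), Real.Gamma_add_one hx0.ne', show x + 1 - 1 = x by ring]
  field_simp
  ring

theorem tendsto_gammaHalfRatio_add_nat {x : ℝ} (hx : 1 < x) :
    Tendsto (fun n : ℕ => gammaHalfRatio (x + n)) atTop (𝓝 1) := by
  have hx' : ∀ n : ℕ, 1 < x + n := fun n => by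
    have := Nat.cast_nonneg (α := ℝ) n
    linarith
  have hinf : Tendsto (fun n : ℕ => (x - 1) + (n : ℝ)) atTop atTop :=
    tendsto_atTop_add_const_left _ _ tendsto_natCast_atTop_atTop
  have hup : Tendsto (fun n : ℕ => 1 + ((x - 1) + (n : ℝ))⁻¹) atTop (𝓝 1) := by
    simpa using (tendsto_inv_atTop_zero.comp hinf).const_add 1
  refine tendsto_of_tendsto_of_tendsto_of_le_of_le tendsto_const_nhds hup
    (fun n => one_le_gammaHalfRatio (hx' n)) fun n => (gammaHalfRatio_le (hx' n)).trans_eq ?_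
  have : x - 1 + (n : ℝ) ≠ 0 := by linarith [hx' n]
  have h2 : x + n - 1 ≠ 0 := by linarith [hx' n]
  field_simp
  ring

/-- A unit shift multiplies the ratio by a factor increasing in its argument, so the quotient of the
value at x + n by that at x is at most the same quotient for y. Both shifted values tend to 1, which
leaves the comparison at x and y. -/
theorem antitoneOn_gammaHalfRatio : AntitoneOn gammaHalfRatio (Ioi 1) := by
  intro x hx y hy hxy
  have hx : 1 < x := hx
  have hy : 1 < y := hy
  have hstep : ∀ n : ℕ, gammaHalfRatio (x + n) * gammaHalfRatio y ≤
      gammaHalfRatio x * gammaHalfRatio (y + n) := by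
    intro n
    induction n with
    | zero => simp
    | succ n ih =>
      have hn := Nat.cast_nonneg (α := ℝ) n
      have hxn : 1 < x + n := by linarith
      have hyn : 1 < y + n := by linarith
      -- A negative factor would carry a value at least 1 to a negative one.
      have hv : 0 ≤ 1 - 3 / (4 * (x + n) ^ 2) - 1 / (4 * (x + n) ^ 3) := by
        have h := gammaHalfRatio_add_one hxn
        have h1 := one_le_gammaHalfRatio (show 1 < x + n + 1 by linarith)
        have h2 := one_le_gammaHalfRatio hxn
        by_contra! hneg
        nlinarith
      have hvv : 1 - 3 / (4 * (x + n) ^ 2) - 1 / (4 * (x + n) ^ 3) ≤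
          1 - 3 / (4 * (y + n) ^ 2) - 1 / (4 * (y + n) ^ 3) := by
        gcongr
      have hry : 0 ≤ gammaHalfRatio x * gammaHalfRatio (y + n) :=
        mul_nonneg (zero_le_one.trans (one_le_gammaHalfRatio hx))
          (zero_le_one.trans (one_le_gammaHalfRatio hyn))
      push_cast
      rw [← add_assoc, ← add_assoc, gammaHalfRatio_add_one hxn, gammaHalfRatio_add_one hyn,
        mul_assoc, mul_left_comm (gammaHalfRatio x)]
      exact mul_le_mul hvv ih (mul_nonneg (zero_le_one.trans (one_le_gammaHalfRatio hxn))
        (zero_le_one.trans (one_le_gammaHalfRatio hy))) (hv.trans hvv)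
  have := le_of_tendsto_of_tendsto' ((tendsto_gammaHalfRatio_add_nat hx).mul_const _)
    ((tendsto_gammaHalfRatio_add_nat hy).const_mul _) hstep
  simpa using this

theorem studentConst_eq_sqrt {ν : ℝ} (hν : 2 < ν) :
    studentConst ν = √(gammaHalfRatio (ν / 2) / (2 * Real.pi)) := by
  have h3 : 0 < ν - 2 := by linarith
  have hpi := Real.pi_pos
  have hG2 : 0 < Real.Gamma (ν / 2) := Real.Gamma_pos_of_pos (by linarith)
  rw [eq_comm, Real.sqrt_eq_iff_mul_self_eq_of_pos (studentConst_pos hν), studentConst,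
    gammaHalfRatio, ← pow_two, div_pow, mul_pow, Real.sq_sqrt (by positivity),
    show ν / 2 + 1 / 2 = (ν + 1) / 2 by ring, show ν / 2 - 1 = (ν - 2) / 2 by ring]
  field_simp

theorem studentConst_anti {ν ν' : ℝ} (hν : 2 < ν) (h : ν ≤ ν') :
    studentConst ν' ≤ studentConst ν := by
  rw [studentConst_eq_sqrt hν, studentConst_eq_sqrt (hν.trans_le h)]
  have := Real.pi_pos
  refine Real.sqrt_le_sqrt (div_le_div_of_nonneg_right ?_ (by positivity))
  exact antitoneOn_gammaHalfRatio (show 1 < ν / 2 by linarith) (show 1 < ν' / 2 by linarith)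
    (by linarith)

theorem le_studentConst {ν : ℝ} (hν : 2 < ν) : √(1 / (2 * Real.pi)) ≤ studentConst ν := by
  rw [studentConst_eq_sqrt hν]
  have := Real.pi_pos
  exact Real.sqrt_le_sqrt
    (div_le_div_of_nonneg_right (one_le_gammaHalfRatio (by linarith)) (by positivity))

/-! ### Uniform ordering and lower bounds for Student tails -/

/-- With m = ν - 2 and z = x², this is minus twice the logarithm of the Student kernel. -/
theorem strictMonoOn_add_three_mul_log {z : ℝ} (hz : 66 ≤ z) :
    StrictMonoOn (fun m => (m + 3) * Real.log (1 + z / m)) (Ioi 2) := by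
  have hderiv : ∀ m : ℝ, 2 < m → HasDerivAt (fun m => (m + 3) * Real.log (1 + z / m))
      (Real.log (1 + z / m) - (m + 3) * z / (m * (m + z))) m := by
    intro m hm
    have hm0 : 0 < m := by linarith
    have hz0 : 0 < z := by linarith
    have hpos : 0 < 1 + z / m := by positivity
    have h1 : HasDerivAt (fun m : ℝ => 1 + z / m) (-z / m ^ 2) m := by
      have := ((hasDerivAt_inv hm0.ne').const_mul z).const_add 1
      convert! this using 1
      ring
    convert! ((hasDerivAt_id m).add_const 3).mul (h1.log hpos.ne') using 1
    simp only [id]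
    field_simp
    ring
  refine strictMonoOn_of_deriv_pos (convex_Ioi 2)
    (fun m hm => (hderiv m hm).continuousAt.continuousWithinAt) fun m hm => ?_
  rw [interior_Ioi] at hm
  have hm : 2 < m := hm
  have hm0 : 0 < m := by linarith
  have hz0 : 0 < z := by linarith
  rw [(hderiv m hm).deriv, sub_pos]
  -- For m > 3.3, log(1+u) ≥ 2u/(u+2) reduces the claim to m(z-6) > 3z, and 3.3 · 60 = 3 · 66. For m
  -- ≤ 3.3, z/m ≥ 66/3.3 = 20 and e³ < 21, so the logarithm exceeds 3, while the subtracted term is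
  -- below 3 because m > 2.
  rcases lt_or_ge 3.3 m with h | h
  · refine lt_of_lt_of_le ?_ (Real.le_log_one_add_of_nonneg (div_pos hz0 hm0).le)
    rw [div_lt_div_iff₀ (by positivity) (by positivity)]
    have e1 : 2 * (z / m) * (m * (m + z)) = 2 * z * (m + z) := by field_simp
    have e2 : (m + 3) * z * (z / m + 2) = z / m * ((m + 3) * (z + 2 * m)) := by field_simp
    rw [e1, e2, div_mul_eq_mul_div, div_lt_iff₀ hm0]
    have : 0 < m * (z - 6) - 3 * z := by nlinarith
    nlinarith [mul_pos hz0 this]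
  · have h20 : 20 ≤ z / m := by
      rw [le_div_iff₀ hm0]
      nlinarith
    have hlog : 3 < Real.log (1 + z / m) := by
      rw [Real.lt_log_iff_exp_lt (by linarith)]
      have he : Real.exp 3 = Real.exp 1 ^ 3 := by rw [← Real.exp_nat_mul]; norm_num
      have h1 := Real.exp_one_lt_d9
      have h2 : Real.exp 1 ^ 3 ≤ 2.72 ^ 3 := by
        have := Real.exp_pos 1
        gcongr
        linarith
      rw [he]
      norm_num at h2
      linarith
    refine lt_trans ?_ hlog
    rw [div_lt_iff₀ (by positivity)]
    nlinarith [mul_pos hm0 hz0]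

theorem studentPDF_lt {ν ν' : ℝ} (hν : 4 < ν) (h : ν < ν') {x : ℝ} (hx : 9 < x) :
    studentPDF ν' (√((ν' - 2) / ν')) x < studentPDF ν (√((ν - 2) / ν)) x := by
  have hν2 : 2 < ν := by linarith
  have hν2' : 2 < ν' := by linarith
  have h3 : 0 < ν - 2 := by linarith
  have h3' : 0 < ν' - 2 := by linarith
  rw [studentPDF_eq hν2, studentPDF_eq hν2']
  refine mul_lt_mul' (studentConst_anti hν2 h.le) ?_ (by positivity) (studentConst_pos hν2)
  have hmono := strictMonoOn_add_three_mul_log (z := x ^ 2) (by nlinarith)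
    (show ν - 2 ∈ Ioi (2 : ℝ) by simp; linarith) (show ν' - 2 ∈ Ioi (2 : ℝ) by simp; linarith)
    (by linarith)
  simp only at hmono
  rw [Real.rpow_def_of_pos (by positivity), Real.rpow_def_of_pos (by positivity), Real.exp_lt_exp]
  linarith

/-- From log(1+u) ≤ u and (ν+1)/(2(ν-2)) ≤ 5/4, the latter equivalent to ν ≥ 4 here. The minorant
does not involve ν. -/
theorem le_studentPDF {ν : ℝ} (hν : 4 < ν) (x : ℝ) :
    √(1 / (2 * Real.pi)) * Real.exp (-(5 / 4 * x ^ 2)) ≤ studentPDF ν (√((ν - 2) / ν)) x := by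
  have hν2 : 2 < ν := by linarith
  have h3 : 0 < ν - 2 := by linarith
  rw [studentPDF_eq hν2]
  refine mul_le_mul (le_studentConst hν2) ?_ (Real.exp_pos _).le (studentConst_pos hν2).le
  rw [Real.rpow_def_of_pos (by positivity), Real.exp_le_exp]
  have hlog := Real.log_le_sub_one_of_pos (show 0 < 1 + x ^ 2 / (ν - 2) by positivity)
  have h1 : (ν + 1) / 2 * (x ^ 2 / (ν - 2)) ≤ 5 / 4 * x ^ 2 := by
    rw [mul_div_assoc', div_le_iff₀ h3]
    nlinarith [sq_nonneg x, mul_nonneg (sq_nonneg x) (show 0 ≤ ν - 4 by linarith)]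
  have h2 := mul_le_mul_of_nonneg_left hlog (show 0 ≤ (ν + 1) / 2 by linarith)
  rw [add_sub_cancel_left] at h2
  linarith

theorem le_real_Ioi_stdStudent {ν : ℝ} (hν : 4 < ν) :
    √(1 / (2 * Real.pi)) * Real.exp (-125) ≤ (stdStudent ν).real (Ioi 9) := by
  have := isProbabilityMeasure_stdStudent (show 2 < ν by linarith)
  refine (ENNReal.ofReal_le_iff_le_toReal (measure_ne_top _ _)).1 ?_
  -- On the unit interval (9, 10] the minorant's exponent is at least -(5/4) · 100 = -125.
  refine le_trans ?_ (measure_mono (Ioc_subset_Ioi_self (a := (10 : ℝ)) (b := 9)))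
  rw [stdStudent, withDensity_apply _ measurableSet_Ioc]
  calc ENNReal.ofReal (√(1 / (2 * Real.pi)) * Real.exp (-125))
      = ∫⁻ _ in Ioc (9 : ℝ) 10, ENNReal.ofReal (√(1 / (2 * Real.pi)) * Real.exp (-125)) := by
        rw [setLIntegral_const, Real.volume_Ioc]
        norm_num
    _ ≤ _ := by
        refine setLIntegral_mono (measurable_studentPDF _ _).ennreal_ofReal fun x hx =>
          ENNReal.ofReal_le_ofReal (le_trans ?_ (le_studentPDF hν x))
        gcongr
        nlinarith [hx.1, hx.2]

theorem minScaleStrictMonoInKurtosis_stdStudent :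
    ∃ τt : ℝ, 0 < τt ∧ ∀ τ ∈ Ioo (0 : ℝ) τt, ∀ α ∈ Ioo (0 : ℝ) 1,
      MinScaleStrictMonoInKurtosis stdStudent (Ioi 4) τ α := by
  have hpi := Real.pi_pos
  refine ⟨min 1 (2 * (√(1 / (2 * Real.pi)) * Real.exp (-125))), by positivity,
    fun τ hτ α hα => ?_⟩
  have hτ1 := hτ.2.trans_le (min_le_left _ _)
  have hτ2 := hτ.2.trans_le (min_le_right _ _)
  have h2 : ∀ ν ∈ Ioi (4 : ℝ), 2 < ν := fun ν hν => lt_trans (by norm_num) hν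
  obtain ⟨hlow, hR⟩ := strictAntiOn_tailRadius (f := fun ν => studentPDF ν (√((ν - 2) / ν)))
    (P := stdStudent) (I := Ioi 4) (τ := τ) (x₀ := 9) (fun ν _ => rfl)
    (fun ν hν => isProbabilityMeasure_stdStudent (h2 ν hν)) (fun ν _ => measurable_studentPDF _ _)
    (fun ν hν x => (studentPDF_pos (h2 ν hν) x).le)
    (fun ν hν ν' _ hlt x hx => studentPDF_lt hν hlt hx) hτ.1 hτ1
    (fun ν hν => by linarith [le_real_Ioi_stdStudent hν])
  exact minScaleStrictMonoInKurtosis hα (fun ν hν => lt_trans (by norm_num) (hlow ν hν))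
    strictAntiOn_kurtosis_stdStudent hR

end Student

end TailCoverage

end

theorem theorem1 :
    (∀ μ : Measure ℝ, TailCoverage.IsStdSymmUnimodal μ →
      ∀ τ ∈ Ioo (0 : ℝ) 1, ∀ α ∈ Ioo (0 : ℝ) 1, ∀ σ : ℝ,
        IsLeast (TailCoverage.feasibleScales μ τ α) σ ↔
          σ = TailCoverage.tailRadius μ τ / TailCoverage.stdNormalQuantile (1 - α / 2)) ∧
    (∀ b₀ b₁ : ℝ, 0 < b₀ → b₀ ≤ b₁ →
      ∃ τGGD : ℝ, 0 < τGGD ∧ ∀ τ ∈ Ioo (0 : ℝ) τGGD, ∀ α ∈ Ioo (0 : ℝ) 1,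
        TailCoverage.MinScaleStrictMonoInKurtosis TailCoverage.ggd (Icc b₀ b₁) τ α) ∧
    (∃ τt : ℝ, 0 < τt ∧ ∀ τ ∈ Ioo (0 : ℝ) τt, ∀ α ∈ Ioo (0 : ℝ) 1,
      TailCoverage.MinScaleStrictMonoInKurtosis TailCoverage.stdStudent (Ioi 4) τ α) := by
  refine ⟨fun μ hμ τ hτ α hα σ => ?_,
    fun b₀ b₁ hb₀ hb => TailCoverage.minScaleStrictMonoInKurtosis_ggd hb₀ hb,
    TailCoverage.minScaleStrictMonoInKurtosis_stdStudent⟩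
  have h := TailCoverage.isLeast_feasibleScales (hμ.tailRadius_pos hτ) hα
  exact ⟨fun hσ => hσ.unique h, fun hσ => hσ ▸ h⟩
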